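/- Let $d\ge 1$, let $\boldsymbol\beta_t\in\mathbb R^d$, $\sigma_t^2>0$ and $\delta>0$, and put $S=\{j\in\{1,\dots,d\}:|\beta_{j,t}|>\delta\}$ and $A=\{1,\dots,d\}$. Assume that $\boldsymbol\beta_t$ is quasi-sparse: $\beta_{j,t}\ne 0$ for all $j$, and $|S|<d$. Let $\mathbf x_1,\mathbf x_2,\dots$ be i.i.d. random vectors in $\mathbb R^d$ with finite second moments whose distribution is non-degenerate, i.e. $P(\mathbf u^T\mathbf x_1=0)<1$ for every $\mathbf u\neq 0$ (this holds in particular if the covariance matrix is nonsingular), and let $y_i=\mathbf x_i^T\boldsymbol\beta_t+\epsilon_i$, where $\epsilon_1,\epsilon_2,\dots$ are i.i.d. $N(0,\sigma_t^2)$ and independent of $(\mathbf x_i)_{i\ge1}$. Write $X_n=(\mathbf x_1,\dots,\mathbf x_n)$ and $\mathbf y_n=(y_1,\dots,y_n)$. For a model $M\subseteq\{1,\dots,d\}$ with $p=|M|$, the Johnson–Rossell product moment prior of order $r\in\{1,2,\dots\}$ with dispersion $\tau>0$ and positive definite scale matrix $A_M\in\mathbb R^{M\times M}$ is the density $$\pi_M(\boldsymbol\beta\mid\sigma^2)=d_M\,(2\pi)^{-p/2}(\tau\sigma^2)^{-rp-p/2}\,|A_M|^{1/2}\exp\Big(-\frac{\boldsymbol\beta^TA_M\boldsymbol\beta}{2\tau\sigma^2}\Big)\prod_{j\in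 M}\beta_j^{2r},\qquad \boldsymbol\beta\in\mathbb R^M,$$ where $d_M$ is the normalizing constant, which does not depend on $\tau$ and $\sigma^2$; coefficients outside $M$ are $0$. The noise variance has under every model the same inverse gamma prior, with density $\pi(\sigma^2)=\frac{b^a}{\Gamma(a)}(\sigma^2)^{-a-1}e^{-b/\sigma^2}$, where $a,b>0$. Let $$p(\mathbf y_n\mid X_n,M)=\int_0^\infty\pi(\sigma^2)\int_{\mathbb R^M}\prod_{i=1}^n N\Big(y_i\,\Big|\,\sum_{j\in M}x_{ij}\beta_j,\ \sigma^2\Big)\,\pi_M(\boldsymbol\beta\mid\sigma^2)\,d\boldsymbol\beta\,d\sigma^2$$ be the marginal likelihood of $M$. Then, as $n\to\infty$ (with $d$, the true parameters and the hyperparameters $r,\tau,A_M,a,b$ fixed), the Bayes factor of $S$ against $A$ tends to zero in probability: $$\frac{p(\mathbf y_n\mid X_n,S)}{p(\mathbf y_n\mid X_n,A)}\ \xrightarrow{\ P\ }\ 0 .$$ -/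

import Mathlib

open MeasureTheory ProbabilityTheory Filter Matrix
open scoped NNReal

noncomputable section

/-- The relevant variables: those whose coefficient exceeds `δ` in absolute value. -/
def relevantSet {d : ℕ} (δ : ℝ) (β : Fin d → ℝ) : Finset (Fin d) :=
  Finset.univ.filter fun j => δ < |β j|

/-- Density of the inverse gamma distribution with shape `a` and scale `b`,
`b ^ a / Γ(a) * s ^ (-a - 1) * exp (-b / s)` for `0 < s`. The scaled inverse chi-square
distribution with parameters `ν`, `η²` is the case `a = ν / 2`, `b = ν * η² / 2`. -/
def invGammaDensity (a b s : ℝ) : ℝ :=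
  b ^ a / Real.Gamma a * s ^ (-a - 1) * Real.exp (-b / s)

/-- The normalizing constant `d_p` of the product moment density of order `r` with scale
matrix `A`: the inverse of the expectation of `∏ i, z i ^ (2 * r)` when `z` is a centered Gaussian
vector with covariance matrix `A⁻¹`. -/
def pmomConst {ι : Type*} [Fintype ι] [DecidableEq ι] (r : ℕ) (A : Matrix ι ι ℝ) : ℝ :=
  (∫ z : ι → ℝ, (2 * Real.pi) ^ (-(Fintype.card ι : ℝ) / 2) * √A.det *
    Real.exp (-(z ⬝ᵥ A *ᵥ z) / 2) * ∏ i, z i ^ (2 * r))⁻¹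

/-- The product moment (pMOM) prior density of order `r` with dispersion `τ` and scale matrix `A`,
of the coefficient vector `b` given the noise variance `s`:
`d_p (2π)^(-p/2) (τ s)^(-r p - p/2) |A|^(1/2) exp (-bᵀ A b / (2 τ s)) ∏ i, b i ^ (2 r)`. -/
def pmomDensity {ι : Type*} [Fintype ι] [DecidableEq ι] (r : ℕ) (τ : ℝ) (A : Matrix ι ι ℝ)
    (s : ℝ) (b : ι → ℝ) : ℝ :=
  pmomConst r A * (2 * Real.pi) ^ (-(Fintype.card ι : ℝ) / 2) *
    (τ * s) ^ (-(r : ℝ) * Fintype.card ι - (Fintype.card ι : ℝ) / 2) * √A.det *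
    Real.exp (-(b ⬝ᵥ A *ᵥ b) / (2 * τ * s)) * ∏ i, b i ^ (2 * r)

/-- The likelihood of the first `n` responses in the normal linear model with covariates `S`,
coefficients `b` (those of the covariates outside `S` are zero) and noise variance `s`. -/
def modelLikelihood {d : ℕ} (S : Finset (Fin d)) (x : ℕ → Fin d → ℝ) (y : ℕ → ℝ) (n : ℕ)
    (s : ℝ) (b : S → ℝ) : ℝ :=
  ∏ i ∈ Finset.range n, gaussianPDFReal (∑ j : S, x i j * b j) s.toNNReal (y i)

/-- The marginal likelihood `p(y_n | X_n, S)` of the model `S`: the coefficients of the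
covariates in `S` have the product moment prior given the noise variance, which has an
inverse gamma prior with parameters `a`, `b`. -/
def pmomMarginal {d : ℕ} (r : ℕ) (τ : ℝ) (A : ∀ S : Finset (Fin d), Matrix S S ℝ) (a b : ℝ)
    (S : Finset (Fin d)) (x : ℕ → Fin d → ℝ) (y : ℕ → ℝ) (n : ℕ) : ℝ :=
  ∫ s in Set.Ioi (0 : ℝ), invGammaDensity a b s *
    ∫ β : S → ℝ, modelLikelihood S x y n s β * pmomDensity r τ (A S) s β

/-- The Bayes factor of the model `S` against the model `S'` based on the first `n` samples. -/
def pmomBayesFactor {d : ℕ} (r : ℕ) (τ : ℝ) (A : ∀ S : Finset (Fin d), Matrix S S ℝ) (a b : ℝ)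
    (S S' : Finset (Fin d)) (x : ℕ → Fin d → ℝ) (y : ℕ → ℝ) (n : ℕ) : ℝ :=
  pmomMarginal r τ A a b S x y n / pmomMarginal r τ A a b S' x y n

end

/-! By the law of large numbers the mean squared residual at coefficients with deviation `u` from
the truth tends to `σ_t² + uᵀ E[x xᵀ] u`, where the second moment matrix is positive definite by
nondegeneracy. The model `S` omits some `j₀` with nonzero true coefficient, so `u j₀` is stuck at
that value and the mean squared residual eventually exceeds some `w > σ_t²`, uniformly over the
coefficients (`exists_eventually_lt_meanSqResidual`). Whatever the variance, the likelihood is then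
at most `q ^ n` with `q = (2πw)^(-1/2) e^(-1/2)`; the priors have finite mass, so the marginal
likelihood of `S` is `O(q ^ n)` (`pmomMarginal_le`).

In the full model, take `s₀` strictly between `σ_t²` and `w`. Near the true coefficients the mean
squared residual is eventually at most `s₀` (`exists_eventually_meanSqResidual_le`). The prior
density is positive at the truth because no true coefficient is zero, so a fixed box around it
contributes at least `K * q' ^ n` with `q' > q` (`le_pmomMarginal`).

The Bayes factor is thus almost surely `O((q / q') ^ n)`, and almost sure convergence implies
convergence in probability. -/

/-! ### Coercivity and the product moment prior -/

/-- A positive definite quadratic form dominates a positive multiple of the squared length. -/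
theorem exists_pos_mul_dotProduct_self_le {ι : Type*} [Fintype ι] (A : Matrix ι ι ℝ)
    (hA : ∀ u : ι → ℝ, u ≠ 0 → 0 < u ⬝ᵥ A *ᵥ u) :
    ∃ c > 0, ∀ u : ι → ℝ, c * (u ⬝ᵥ u) ≤ u ⬝ᵥ A *ᵥ u := by
  have hq : Continuous fun u : ι → ℝ => u ⬝ᵥ A *ᵥ u := by fun_prop
  have hl : Continuous fun u : ι → ℝ => u ⬝ᵥ u := by fun_prop
  have hl0 : ∀ u : ι → ℝ, u ≠ 0 → 0 < u ⬝ᵥ u := fun u hu =>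
    lt_of_le_of_ne (Finset.sum_nonneg fun i _ => mul_self_nonneg _)
      fun h => hu (dotProduct_self_eq_zero.1 h.symm)
  have hsph : ∀ u ∈ Metric.sphere (0 : ι → ℝ) 1, u ≠ 0 := by
    rintro u hu rfl
    simp at hu
  rcases (Metric.sphere (0 : ι → ℝ) 1).eq_empty_or_nonempty with he | hne
  · refine ⟨1, one_pos, fun u => ?_⟩
    have hu : u = 0 := by
      by_contra hu
      have : ‖u‖⁻¹ • u ∈ Metric.sphere (0 : ι → ℝ) 1 := by
        simp [norm_smul, norm_ne_zero_iff.2 hu]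
      simp [he] at this
    simp [hu]
  -- The Rayleigh quotient is homogeneous of degree zero, so its minimum over the compact sphere is
  -- a bound everywhere.
  · obtain ⟨m, hm, hmin⟩ := (isCompact_sphere (0 : ι → ℝ) 1).exists_isMinOn hne
      (f := fun u => (u ⬝ᵥ A *ᵥ u) / (u ⬝ᵥ u))
      (hq.continuousOn.div hl.continuousOn fun u hu => (hl0 u (hsph u hu)).ne')
    refine ⟨_, div_pos (hA m (hsph m hm)) (hl0 m (hsph m hm)), fun u => ?_⟩
    rcases eq_or_ne u 0 with rfl | hu
    · simp
    have hn : ‖u‖ ≠ 0 := norm_ne_zero_iff.2 hu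
    have h := hmin (show ‖u‖⁻¹ • u ∈ Metric.sphere (0 : ι → ℝ) 1 by simp [norm_smul, hn])
    simp only [Set.mem_ofPred_eq, smul_dotProduct, dotProduct_smul, mulVec_smul, smul_eq_mul] at h
    rw [← le_div_iff₀ (hl0 u hu)]
    refine h.trans_eq ?_
    have := (hl0 u hu).ne'
    field_simp

theorem integrable_exp_neg_mul_sq_mul_pow {c : ℝ} (hc : 0 < c) (k : ℕ) :
    Integrable fun t : ℝ => Real.exp (-(c * t ^ 2)) * t ^ k := by
  have h := integrable_rpow_mul_exp_neg_mul_sq hc (s := (k : ℝ))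
    (by have : (0 : ℝ) ≤ k := k.cast_nonneg
        linarith)
  refine h.congr (ae_of_all _ fun t => ?_)
  simp only [Real.rpow_natCast]
  rw [mul_comm, neg_mul]

/-- Polynomially weighted Gaussian functions are integrable. -/
theorem integrable_exp_neg_quadratic_mul_prod_pow {ι : Type*} [Fintype ι] [DecidableEq ι]
    {A : Matrix ι ι ℝ} (hA : A.PosDef) {t : ℝ} (ht : 0 < t) (r : ℕ) :
    Integrable fun z : ι → ℝ => Real.exp (-(z ⬝ᵥ A *ᵥ z) / t) * ∏ i, z i ^ (2 * r) := by
  obtain ⟨c, hc, hcA⟩ := exists_pos_mul_dotProduct_self_le A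
    fun u hu => by simpa using hA.dotProduct_mulVec_pos hu
  have hI : Integrable fun z : ι → ℝ => ∏ i, (Real.exp (-(c / t * z i ^ 2)) * z i ^ (2 * r)) :=
    Integrable.fintype_prod (f := fun _ u => Real.exp (-(c / t * u ^ 2)) * u ^ (2 * r))
      fun _ => integrable_exp_neg_mul_sq_mul_pow (div_pos hc ht) _
  refine hI.mono' (by fun_prop) (ae_of_all _ fun z => ?_)
  have h0 : 0 ≤ ∏ i, z i ^ (2 * r) := Finset.prod_nonneg fun i _ => (even_two_mul r).pow_nonneg _
  rw [Real.norm_of_nonneg (by positivity), Finset.prod_mul_distrib, ← Real.exp_sum]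
  refine mul_le_mul_of_nonneg_right (Real.exp_le_exp.2 ?_) h0
  rw [Finset.sum_neg_distrib, ← Finset.mul_sum, neg_div, neg_le_neg_iff, div_mul_eq_mul_div]
  refine div_le_div_of_nonneg_right ((hcA z).trans' (le_of_eq ?_)) ht.le
  simp [dotProduct, sq]

theorem integral_exp_neg_quadratic_mul_prod_pow_pos {ι : Type*} [Fintype ι] [DecidableEq ι]
    {A : Matrix ι ι ℝ} (hA : A.PosDef) (r : ℕ) :
    0 < ∫ z : ι → ℝ, Real.exp (-(z ⬝ᵥ A *ᵥ z) / 2) * ∏ i, z i ^ (2 * r) := by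
  have hc : Continuous fun z : ι → ℝ => Real.exp (-(z ⬝ᵥ A *ᵥ z) / 2) * ∏ i, z i ^ (2 * r) := by
    fun_prop
  rw [integral_pos_iff_support_of_nonneg
    (fun z => mul_nonneg (Real.exp_pos _).le
      (Finset.prod_nonneg fun i _ => (even_two_mul r).pow_nonneg _))
    (integrable_exp_neg_quadratic_mul_prod_pow hA two_pos r)]
  refine hc.isOpen_support.measure_pos _ ⟨fun _ => 1, ?_⟩
  simp

theorem pmomConst_eq {ι : Type*} [Fintype ι] [DecidableEq ι] (r : ℕ) (A : Matrix ι ι ℝ) :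
    pmomConst r A = ((2 * Real.pi) ^ (-(Fintype.card ι : ℝ) / 2) * √A.det *
      ∫ z : ι → ℝ, Real.exp (-(z ⬝ᵥ A *ᵥ z) / 2) * ∏ i, z i ^ (2 * r))⁻¹ := by
  simp only [pmomConst, mul_assoc, integral_const_mul]

theorem pmomConst_pos {ι : Type*} [Fintype ι] [DecidableEq ι] (r : ℕ) {A : Matrix ι ι ℝ}
    (hA : A.PosDef) : 0 < pmomConst r A := by
  rw [pmomConst_eq]
  have h1 := integral_exp_neg_quadratic_mul_prod_pow_pos hA r
  have h2 := Real.sqrt_pos.2 hA.det_pos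
  positivity

theorem pmomDensity_nonneg {ι : Type*} [Fintype ι] [DecidableEq ι] (r : ℕ) {τ : ℝ} (hτ : 0 < τ)
    {A : Matrix ι ι ℝ} (hA : A.PosDef) {s : ℝ} (hs : 0 < s) (β : ι → ℝ) :
    0 ≤ pmomDensity r τ A s β := by
  have h1 := pmomConst_pos r hA
  have h0 : 0 ≤ ∏ i, β i ^ (2 * r) := Finset.prod_nonneg fun i _ => (even_two_mul r).pow_nonneg _
  unfold pmomDensity
  positivity

/-- The moment factor vanishes on the coordinate hyperplanes, so every coordinate must be nonzero.
This is why the full model needs all true coefficients to be nonzero. -/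
theorem pmomDensity_pos {ι : Type*} [Fintype ι] [DecidableEq ι] (r : ℕ) {τ : ℝ} (hτ : 0 < τ)
    {A : Matrix ι ι ℝ} (hA : A.PosDef) {s : ℝ} (hs : 0 < s) {β : ι → ℝ} (hβ : ∀ i, β i ≠ 0) :
    0 < pmomDensity r τ A s β := by
  have h1 := pmomConst_pos r hA
  have h2 := Real.sqrt_pos.2 hA.det_pos
  have h0 : 0 < ∏ i, β i ^ (2 * r) :=
    Finset.prod_pos fun i _ => (even_two_mul r).pow_pos (hβ i)
  unfold pmomDensity
  positivity

theorem measurable_uncurry_pmomDensity {ι : Type*} [Fintype ι] [DecidableEq ι] (r : ℕ) (τ : ℝ)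
    (A : Matrix ι ι ℝ) : Measurable fun p : ℝ × (ι → ℝ) => pmomDensity r τ A p.1 p.2 := by
  have h : Measurable fun p : ℝ × (ι → ℝ) => p.2 ⬝ᵥ A *ᵥ p.2 :=
    Continuous.measurable (by fun_prop)
  unfold pmomDensity
  fun_prop

theorem continuousAt_pmomDensity {ι : Type*} [Fintype ι] [DecidableEq ι] (r : ℕ) {τ : ℝ}
    (hτ : 0 < τ) (A : Matrix ι ι ℝ) {s : ℝ} (hs : 0 < s) (β : ι → ℝ) :
    ContinuousAt (fun p : ℝ × (ι → ℝ) => pmomDensity r τ A p.1 p.2) (s, β) := by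
  unfold pmomDensity
  have h1 : ContinuousAt (fun p : ℝ × (ι → ℝ) =>
      (τ * p.1) ^ (-(r : ℝ) * Fintype.card ι - (Fintype.card ι : ℝ) / 2)) (s, β) :=
    ContinuousAt.rpow_const (by fun_prop) (Or.inl (mul_pos hτ hs).ne')
  have h2 : ContinuousAt (fun p : ℝ × (ι → ℝ) =>
      Real.exp (-(p.2 ⬝ᵥ A *ᵥ p.2) / (2 * τ * p.1))) (s, β) :=
    (ContinuousAt.div (by fun_prop) (by fun_prop) (by positivity)).rexp
  have h3 : ContinuousAt (fun p : ℝ × (ι → ℝ) => ∏ i, p.2 i ^ (2 * r)) (s, β) := by fun_prop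
  exact (((continuousAt_const.mul h1).mul continuousAt_const).mul h2).mul h3

theorem integrable_pmomDensity {ι : Type*} [Fintype ι] [DecidableEq ι] (r : ℕ) {τ : ℝ}
    (hτ : 0 < τ) {A : Matrix ι ι ℝ} (hA : A.PosDef) {s : ℝ} (hs : 0 < s) :
    Integrable (pmomDensity r τ A s) := by
  have h := (integrable_exp_neg_quadratic_mul_prod_pow hA (t := 2 * τ * s) (by positivity)
    r).const_mul (pmomConst r A * (2 * Real.pi) ^ (-(Fintype.card ι : ℝ) / 2) *
    (τ * s) ^ (-(r : ℝ) * Fintype.card ι - (Fintype.card ι : ℝ) / 2) * √A.det)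
  refine h.congr (ae_of_all _ fun β => ?_)
  simp only [pmomDensity, mul_assoc]

/-- The product moment prior is a probability density. -/
theorem integral_pmomDensity {ι : Type*} [Fintype ι] [DecidableEq ι] (r : ℕ) {τ : ℝ}
    (hτ : 0 < τ) {A : Matrix ι ι ℝ} (hA : A.PosDef) {s : ℝ} (hs : 0 < s) :
    ∫ β, pmomDensity r τ A s β = 1 := by
  have hI := integral_exp_neg_quadratic_mul_prod_pow_pos hA r
  have h2 := Real.sqrt_pos.2 hA.det_pos
  have hts : 0 < τ * s := mul_pos hτ hs
  have hR : 0 < √(τ * s) := Real.sqrt_pos.2 hts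
  -- The substitution `β = √(τ s) z` reduces to unit dispersion.
  have hscale := Measure.integral_comp_smul (volume : Measure (ι → ℝ))
    (fun β => Real.exp (-(β ⬝ᵥ A *ᵥ β) / (2 * τ * s)) * ∏ i, β i ^ (2 * r)) √(τ * s)
  have hl : ∀ z : ι → ℝ, Real.exp (-((√(τ * s) • z) ⬝ᵥ A *ᵥ (√(τ * s) • z)) / (2 * τ * s)) *
      ∏ i, (√(τ * s) • z) i ^ (2 * r) =
      √(τ * s) ^ (2 * r * Fintype.card ι) *
        (Real.exp (-(z ⬝ᵥ A *ᵥ z) / 2) * ∏ i, z i ^ (2 * r)) := by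
    intro z
    simp only [smul_dotProduct, dotProduct_smul, mulVec_smul, smul_eq_mul, Pi.smul_apply, mul_pow,
      Finset.prod_mul_distrib, Finset.prod_const, Finset.card_univ, ← pow_mul]
    rw [← mul_assoc (√(τ * s)) (√(τ * s)), Real.mul_self_sqrt hts.le]
    have : -(τ * s * (z ⬝ᵥ A *ᵥ z)) / (2 * τ * s) = -(z ⬝ᵥ A *ᵥ z) / 2 := by
      field_simp
    rw [this]
    ring
  simp only [hl, integral_const_mul, smul_eq_mul] at hscale
  rw [abs_of_pos (by positivity), Module.finrank_fintype_fun_eq_card,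
    eq_inv_mul_iff_mul_eq₀ (by positivity)] at hscale
  -- The power of `τ s` in the density cancels the Jacobian together with the scaling of the moment
  -- factor.
  have hexp : (τ * s) ^ (-(r : ℝ) * Fintype.card ι - (Fintype.card ι : ℝ) / 2) =
      (√(τ * s) ^ Fintype.card ι * √(τ * s) ^ (2 * r * Fintype.card ι))⁻¹ := by
    rw [← pow_add, ← Real.rpow_natCast, Real.sqrt_eq_rpow, ← Real.rpow_mul hts.le,
      ← Real.rpow_neg hts.le]
    congr 1
    push_cast
    ring
  simp only [pmomDensity, mul_assoc, integral_const_mul]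
  simp only [← mul_assoc] at hscale ⊢
  rw [mul_assoc, ← hscale, hexp, pmomConst_eq]
  generalize (∫ z : ι → ℝ, Real.exp (-(z ⬝ᵥ A *ᵥ z) / 2) * ∏ i, z i ^ (2 * r)) = I at hI ⊢
  field_simp

/-! ### The inverse gamma prior -/

theorem invGammaDensity_pos {a b s : ℝ} (ha : 0 < a) (hb : 0 < b) (hs : 0 < s) :
    0 < invGammaDensity a b s := by
  have := Real.Gamma_pos_of_pos ha
  unfold invGammaDensity
  positivity

theorem measurable_invGammaDensity (a b : ℝ) : Measurable (invGammaDensity a b) := by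
  unfold invGammaDensity
  fun_prop

theorem continuousAt_invGammaDensity (a b : ℝ) {s : ℝ} (hs : 0 < s) :
    ContinuousAt (invGammaDensity a b) s := by
  unfold invGammaDensity
  exact (continuousAt_const.mul (continuousAt_id.rpow_const (Or.inl hs.ne'))).mul
    (continuousAt_const.div continuousAt_id hs.ne').rexp

/-- The substitution `s ↦ s⁻¹` turns this into the gamma integral. -/
theorem integrableOn_rpow_mul_exp_neg_div {a b : ℝ} (ha : 0 < a) (hb : 0 < b) :
    IntegrableOn (fun s : ℝ => s ^ (-a - 1) * Real.exp (-b / s)) (Set.Ioi 0) := by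
  have h := integrableOn_rpow_mul_exp_neg_mul_rpow (p := 1) (s := a - 1) (by linarith) one_pos hb
  rw [← integrableOn_Ioi_comp_rpow_iff _ (p := -1) (by norm_num)] at h
  refine h.congr_fun (fun s hs => ?_) measurableSet_Ioi
  have hs' : (0 : ℝ) < s := hs
  simp only [Real.rpow_one, Real.rpow_neg_one, smul_eq_mul, abs_neg, abs_one, one_mul]
  rw [← mul_assoc, ← Real.rpow_neg_one s, ← Real.rpow_mul hs'.le, ← Real.rpow_add hs',
    Real.rpow_neg_one]
  congr 2
  ring

/-- Inverse gamma densities with a bigger shape are integrable, hence so is the product of an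
inverse gamma density and the supremum of the Gaussian likelihood. -/
theorem integrableOn_invGammaDensity_mul_pow {a b : ℝ} (ha : 0 < a) (hb : 0 < b) (n : ℕ) :
    IntegrableOn (fun s => invGammaDensity a b s * (√(2 * Real.pi * s))⁻¹ ^ n) (Set.Ioi 0) := by
  have h := (integrableOn_rpow_mul_exp_neg_div (a := a + n / 2) (by positivity) hb).const_mul
    (b ^ a / Real.Gamma a * (√(2 * Real.pi))⁻¹ ^ n)
  refine IntegrableOn.congr_fun h (fun s hs => ?_) measurableSet_Ioi
  have hs' : (0 : ℝ) < s := hs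
  have e : s ^ (-(a + n / 2) - 1) = s ^ (-a - 1) * (√s)⁻¹ ^ n := by
    rw [inv_pow, ← Real.rpow_natCast, Real.sqrt_eq_rpow, ← Real.rpow_mul hs'.le,
      ← Real.rpow_neg hs'.le, ← Real.rpow_add hs']
    congr 1
    ring
  simp only [invGammaDensity]
  rw [e, Real.sqrt_mul (x := 2 * Real.pi) (by positivity), mul_inv, mul_pow]
  ring

theorem integrableOn_invGammaDensity {a b : ℝ} (ha : 0 < a) (hb : 0 < b) :
    IntegrableOn (invGammaDensity a b) (Set.Ioi 0) := by
  simpa using integrableOn_invGammaDensity_mul_pow ha hb 0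

/-! ### The Gaussian likelihood and its measurability -/

section likelihood

variable {d : ℕ} (S : Finset (Fin d))

theorem modelLikelihood_eq (x : ℕ → Fin d → ℝ) (y : ℕ → ℝ) (n : ℕ) {s : ℝ} (hs : 0 < s)
    (β : S → ℝ) :
    modelLikelihood S x y n s β = (√(2 * Real.pi * s))⁻¹ ^ n *
      Real.exp (-(∑ i ∈ Finset.range n, (y i - ∑ j : S, x i j * β j) ^ 2) / (2 * s)) := by
  simp only [modelLikelihood, gaussianPDFReal, Real.coe_toNNReal s hs.le, Finset.prod_mul_distrib,
    Finset.prod_const, Finset.card_range, ← Real.exp_sum, ← Finset.sum_div, Finset.sum_neg_distrib]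

theorem modelLikelihood_nonneg (x : ℕ → Fin d → ℝ) (y : ℕ → ℝ) (n : ℕ) (s : ℝ) (β : S → ℝ) :
    0 ≤ modelLikelihood S x y n s β :=
  Finset.prod_nonneg fun _ _ => gaussianPDFReal_nonneg _ _ _

theorem modelLikelihood_le (x : ℕ → Fin d → ℝ) (y : ℕ → ℝ) (n : ℕ) {s : ℝ} (hs : 0 < s)
    (β : S → ℝ) : modelLikelihood S x y n s β ≤ (√(2 * Real.pi * s))⁻¹ ^ n := by
  rw [modelLikelihood_eq S x y n hs]
  refine mul_le_of_le_one_right (by positivity) (Real.exp_le_one_iff.2 ?_)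
  rw [neg_div]
  exact neg_nonpos.2 (div_nonneg (Finset.sum_nonneg fun _ _ => sq_nonneg _) (by positivity))

/-- An `n`-th power with base independent of the data isolates the exponential rate, the only thing
compared between the models. -/
theorem modelLikelihood_le_pow {x : ℕ → Fin d → ℝ} {y : ℕ → ℝ} {n : ℕ} {s : ℝ} (hs : 0 < s)
    {β : S → ℝ} {w : ℝ} (h : n * w ≤ ∑ i ∈ Finset.range n, (y i - ∑ j : S, x i j * β j) ^ 2) :
    modelLikelihood S x y n s β ≤
      ((√(2 * Real.pi * s))⁻¹ * Real.exp (-(w / (2 * s)))) ^ n := by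
  rw [modelLikelihood_eq S x y n hs, mul_pow, ← Real.exp_nat_mul]
  refine mul_le_mul_of_nonneg_left (Real.exp_le_exp.2 ?_) (by positivity)
  rw [neg_div, mul_neg, neg_le_neg_iff, ← mul_div_assoc]
  gcongr

theorem pow_le_modelLikelihood {x : ℕ → Fin d → ℝ} {y : ℕ → ℝ} {n : ℕ} {s : ℝ} (hs : 0 < s)
    {β : S → ℝ} {w : ℝ} (h : ∑ i ∈ Finset.range n, (y i - ∑ j : S, x i j * β j) ^ 2 ≤ n * w) :
    ((√(2 * Real.pi * s))⁻¹ * Real.exp (-(w / (2 * s)))) ^ n ≤ modelLikelihood S x y n s β := by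
  rw [modelLikelihood_eq S x y n hs, mul_pow, ← Real.exp_nat_mul]
  refine mul_le_mul_of_nonneg_left (Real.exp_le_exp.2 ?_) (by positivity)
  rw [neg_div, mul_neg, neg_le_neg_iff, ← mul_div_assoc]
  gcongr

/-- The Gaussian likelihood with mean squared residual `w` is maximal at the variance `w`. -/
theorem inv_sqrt_mul_exp_neg_le {s w : ℝ} (hs : 0 < s) (hw : 0 < w) :
    (√(2 * Real.pi * s))⁻¹ * Real.exp (-(w / (2 * s))) ≤
      (√(2 * Real.pi * w))⁻¹ * Real.exp (-(1 / 2)) := by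
  rw [Real.exp_neg, Real.exp_neg, ← mul_inv, ← mul_inv]
  refine inv_anti₀ (by positivity) ?_
  rw [Real.sqrt_mul (by positivity), Real.sqrt_mul (by positivity) s, mul_assoc, mul_assoc]
  refine mul_le_mul_of_nonneg_left ?_ (Real.sqrt_nonneg _)
  refine abs_le_of_sq_le_sq' ?_ (by positivity) |>.2
  rw [mul_pow, mul_pow, Real.sq_sqrt hs.le, Real.sq_sqrt hw.le, ← Real.exp_nat_mul,
    ← Real.exp_nat_mul]
  -- After squaring, the claim is `w ≤ s * exp (w / s - 1)`, that is, `1 + t ≤ exp t` at `t = w / s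
  -- - 1`.
  have h := Real.add_one_le_exp (w / s - 1)
  rw [sub_add_cancel, div_le_iff₀ hs] at h
  have e1 : ((2 : ℕ) : ℝ) * (1 / 2) = 1 := by norm_num
  have e2 : ((2 : ℕ) : ℝ) * (w / (2 * s)) = (w / s - 1) + 1 := by
    push_cast
    field_simp
    ring
  rw [e1, e2, Real.exp_add]
  nlinarith [Real.exp_pos 1]

variable {Ω : Type*} [MeasurableSpace Ω]

theorem measurable_modelLikelihood {x : ℕ → Ω → Fin d → ℝ} {y : ℕ → Ω → ℝ}
    (hx : ∀ i, Measurable (x i)) (hy : ∀ i, Measurable (y i)) (n : ℕ) :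
    Measurable fun p : (Ω × ℝ) × (S → ℝ) =>
      modelLikelihood S (fun i => x i p.1.1) (fun i => y i p.1.1) n p.1.2 p.2 := by
  unfold modelLikelihood
  refine Finset.measurable_prod _ fun i _ => ?_
  have h : Measurable fun p : (Ω × ℝ) × (S → ℝ) => ∑ j : S, x i p.1.1 j * p.2 j := by
    refine Finset.measurable_sum _ fun j _ => ?_
    have : Measurable fun p : (Ω × ℝ) × (S → ℝ) => x i p.1.1 := by fun_prop
    exact (measurable_pi_apply (j : Fin d)).comp this |>.mul (by fun_prop)
  exact measurable_uncurry_gaussianPDFReal.comp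
    (h.prodMk ((by fun_prop : Measurable fun p : (Ω × ℝ) × (S → ℝ) => p.1.2.toNNReal).prodMk
      (by fun_prop : Measurable fun p : (Ω × ℝ) × (S → ℝ) => y i p.1.1)))

theorem stronglyMeasurable_integral_modelLikelihood_mul_pmomDensity {x : ℕ → Ω → Fin d → ℝ}
    {y : ℕ → Ω → ℝ} (hx : ∀ i, Measurable (x i)) (hy : ∀ i, Measurable (y i)) (n r : ℕ) (τ : ℝ)
    (A : Matrix S S ℝ) :
    StronglyMeasurable fun p : Ω × ℝ => ∫ β : S → ℝ,
      modelLikelihood S (fun i => x i p.1) (fun i => y i p.1) n p.2 β *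
        pmomDensity r τ A p.2 β := by
  refine StronglyMeasurable.integral_prod_right' (f := fun p : (Ω × ℝ) × (S → ℝ) =>
    modelLikelihood S (fun i => x i p.1.1) (fun i => y i p.1.1) n p.1.2 p.2 *
        pmomDensity r τ A p.1.2 p.2) (Measurable.stronglyMeasurable ?_)
  refine (measurable_modelLikelihood S hx hy n).mul ?_
  exact (measurable_uncurry_pmomDensity r τ A).comp
    (by fun_prop : Measurable fun p : (Ω × ℝ) × (S → ℝ) => (p.1.2, p.2))

/-- Measurability in the sample point is what lets almost sure convergence be turned into
convergence in measure. -/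
theorem measurable_pmomMarginal {x : ℕ → Ω → Fin d → ℝ} {y : ℕ → Ω → ℝ}
    (hx : ∀ i, Measurable (x i)) (hy : ∀ i, Measurable (y i)) (n r : ℕ) (τ : ℝ)
    (A : ∀ S : Finset (Fin d), Matrix S S ℝ) (a b : ℝ) :
    Measurable fun ω => pmomMarginal r τ A a b S (fun i => x i ω) (fun i => y i ω) n := by
  unfold pmomMarginal
  refine (StronglyMeasurable.integral_prod_right' (f := fun p : Ω × ℝ => invGammaDensity a b p.2 *
    ∫ β : S → ℝ, modelLikelihood S (fun i => x i p.1) (fun i => y i p.1) n p.2 β *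
      pmomDensity r τ (A S) p.2 β) ?_).measurable
  exact ((measurable_invGammaDensity a b).comp measurable_snd).stronglyMeasurable.mul
    (stronglyMeasurable_integral_modelLikelihood_mul_pmomDensity S hx hy n r τ (A S))

end likelihood

/-! ### Bounds of the marginal likelihood -/

section marginal

variable {d : ℕ} {S : Finset (Fin d)} {x : ℕ → Fin d → ℝ} {y : ℕ → ℝ} {n r : ℕ} {τ : ℝ}

theorem integrable_modelLikelihood_mul_pmomDensity (hτ : 0 < τ) {A : Matrix S S ℝ}
    (hA : A.PosDef) {s : ℝ} (hs : 0 < s) :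
    Integrable fun β => modelLikelihood S x y n s β * pmomDensity r τ A s β := by
  -- Fixed data are random data on a one-point space.
  have hm : Measurable fun β : S → ℝ => modelLikelihood S x y n s β :=
    (measurable_modelLikelihood S (Ω := Unit) (x := fun i _ => x i) (y := fun i _ => y i)
      (fun _ => measurable_const) (fun _ => measurable_const) n).comp
      (by fun_prop : Measurable fun β : S → ℝ => (((), s), β))
  refine (integrable_pmomDensity r hτ hA hs).bdd_mul hm.aestronglyMeasurable
    (c := (√(2 * Real.pi * s))⁻¹ ^ n) (ae_of_all _ fun β => ?_)
  rw [Real.norm_of_nonneg (modelLikelihood_nonneg S x y n s β)]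
  exact modelLikelihood_le S x y n hs β

theorem integral_modelLikelihood_mul_pmomDensity_nonneg (hτ : 0 < τ) {A : Matrix S S ℝ}
    (hA : A.PosDef) {s : ℝ} (hs : 0 < s) :
    0 ≤ ∫ β, modelLikelihood S x y n s β * pmomDensity r τ A s β :=
  integral_nonneg fun β => mul_nonneg (modelLikelihood_nonneg S x y n s β)
    (pmomDensity_nonneg r hτ hA hs β)

/-- The prior has mass one, so a bound uniform in the coefficients survives averaging. -/
theorem integral_modelLikelihood_mul_pmomDensity_le (hτ : 0 < τ) {A : Matrix S S ℝ}
    (hA : A.PosDef) {s : ℝ} (hs : 0 < s) {c : ℝ}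
    (hc : ∀ β, modelLikelihood S x y n s β ≤ c) :
    ∫ β, modelLikelihood S x y n s β * pmomDensity r τ A s β ≤ c := by
  calc ∫ β, modelLikelihood S x y n s β * pmomDensity r τ A s β
      ≤ ∫ β, c * pmomDensity r τ A s β :=
        integral_mono (integrable_modelLikelihood_mul_pmomDensity hτ hA hs)
          ((integrable_pmomDensity r hτ hA hs).const_mul c) fun β =>
          mul_le_mul_of_nonneg_right (hc β) (pmomDensity_nonneg r hτ hA hs β)
    _ = c := by rw [integral_const_mul, integral_pmomDensity r hτ hA hs, mul_one]

variable {A : ∀ S : Finset (Fin d), Matrix S S ℝ} {a b : ℝ}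

theorem integrableOn_pmomMarginal_integrand (hτ : 0 < τ) (hA : (A S).PosDef) (ha : 0 < a)
    (hb : 0 < b) :
    IntegrableOn (fun s => invGammaDensity a b s *
      ∫ β : S → ℝ, modelLikelihood S x y n s β * pmomDensity r τ (A S) s β) (Set.Ioi 0) := by
  have hm := (stronglyMeasurable_integral_modelLikelihood_mul_pmomDensity S (Ω := Unit)
    (x := fun i _ => x i) (y := fun i _ => y i)
    (fun _ => measurable_const) (fun _ => measurable_const) n r τ (A S)).comp_measurable
    (by fun_prop : Measurable fun s : ℝ => ((), s))
  refine Integrable.mono' (integrableOn_invGammaDensity_mul_pow ha hb n)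
    ((measurable_invGammaDensity a b).stronglyMeasurable.mul hm).aestronglyMeasurable ?_
  refine (ae_restrict_mem measurableSet_Ioi).mono fun s hs => ?_
  have h0 := invGammaDensity_pos ha hb hs
  rw [Real.norm_of_nonneg (mul_nonneg h0.le
    (integral_modelLikelihood_mul_pmomDensity_nonneg hτ hA hs))]
  exact mul_le_mul_of_nonneg_left (integral_modelLikelihood_mul_pmomDensity_le hτ hA hs
    (modelLikelihood_le S x y n hs)) h0.le

theorem pmomMarginal_nonneg (hτ : 0 < τ) (hA : (A S).PosDef) (ha : 0 < a) (hb : 0 < b) :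
    0 ≤ pmomMarginal r τ A a b S x y n :=
  setIntegral_nonneg measurableSet_Ioi fun _ hs => mul_nonneg (invGammaDensity_pos ha hb hs).le
    (integral_modelLikelihood_mul_pmomDensity_nonneg hτ hA hs)

/-- A lower bound of the mean squared residuals gives an upper bound of the marginal likelihood. -/
theorem pmomMarginal_le (hτ : 0 < τ) (hA : (A S).PosDef) (ha : 0 < a) (hb : 0 < b)
    {w : ℝ} (hw : 0 < w)
    (h : ∀ β : S → ℝ, n * w ≤ ∑ i ∈ Finset.range n, (y i - ∑ j : S, x i j * β j) ^ 2) :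
    pmomMarginal r τ A a b S x y n ≤ (∫ s in Set.Ioi 0, invGammaDensity a b s) *
      ((√(2 * Real.pi * w))⁻¹ * Real.exp (-(1 / 2))) ^ n := by
  rw [← integral_mul_const]
  refine setIntegral_mono_on (integrableOn_pmomMarginal_integrand hτ hA ha hb)
    ((integrableOn_invGammaDensity ha hb).mul_const _) measurableSet_Ioi fun s hs => ?_
  have hs' : (0 : ℝ) < s := hs
  refine mul_le_mul_of_nonneg_left ?_ (invGammaDensity_pos ha hb hs).le
  refine integral_modelLikelihood_mul_pmomDensity_le hτ hA hs fun β => ?_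
  refine (modelLikelihood_le_pow S hs (h β)).trans ?_
  exact pow_le_pow_left₀ (by positivity) (inv_sqrt_mul_exp_neg_le hs hw) n

/-- The marginal likelihood is at least the contribution of a box of parameter values. -/
theorem le_pmomMarginal (hτ : 0 < τ) (hA : (A S).PosDef) (ha : 0 < a) (hb : 0 < b)
    {B : Set ℝ} (hB : MeasurableSet B) (hB0 : B ⊆ Set.Ioi 0) (hBfin : volume B ≠ ⊤)
    {U : Set (S → ℝ)} (hU : MeasurableSet U) (hUfin : volume U ≠ ⊤) {c q w : ℝ} (hc0 : 0 ≤ c)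
    (hq0 : 0 ≤ q)
    (hc : ∀ s ∈ B, ∀ β ∈ U, c ≤ invGammaDensity a b s * pmomDensity r τ (A S) s β)
    (hq : ∀ s ∈ B, q ≤ (√(2 * Real.pi * s))⁻¹ * Real.exp (-(w / (2 * s))))
    (hw : ∀ β ∈ U, ∑ i ∈ Finset.range n, (y i - ∑ j : S, x i j * β j) ^ 2 ≤ n * w) :
    c * volume.real U * volume.real B * q ^ n ≤ pmomMarginal r τ A a b S x y n := by
  have hI := integrableOn_pmomMarginal_integrand (x := x) (y := y) (n := n) (r := r) hτ hA ha hb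
  have hinner : ∀ s ∈ B, c * volume.real U * q ^ n ≤ invGammaDensity a b s *
      ∫ β : S → ℝ, modelLikelihood S x y n s β * pmomDensity r τ (A S) s β := by
    intro s hs
    have hs0 : 0 < s := hB0 hs
    have hi := (integrable_modelLikelihood_mul_pmomDensity (x := x) (y := y) (n := n) (r := r) hτ hA
      hs0).const_mul (invGammaDensity a b s)
    have hg := invGammaDensity_pos ha hb hs0
    rw [← integral_const_mul]
    calc c * volume.real U * q ^ n = ∫ _ in U, c * q ^ n := by
          rw [setIntegral_const, smul_eq_mul]
          ring
      _ ≤ ∫ β in U, invGammaDensity a b s *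
            (modelLikelihood S x y n s β * pmomDensity r τ (A S) s β) := by
          refine setIntegral_mono_on (integrableOn_const hUfin) hi.integrableOn hU
            fun β hβ => ?_
          rw [mul_left_comm, mul_comm c]
          refine mul_le_mul ?_ (hc s hs β hβ) hc0 (modelLikelihood_nonneg S x y n s β)
          exact (pow_le_pow_left₀ hq0 (hq s hs) n).trans (pow_le_modelLikelihood S hs0 (hw β hβ))
      _ ≤ _ := setIntegral_le_integral hi (ae_of_all _ fun β => mul_nonneg hg.le
          (mul_nonneg (modelLikelihood_nonneg S x y n s β) (pmomDensity_nonneg r hτ hA hs0 β)))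
  calc c * volume.real U * volume.real B * q ^ n
      = ∫ _ in B, c * volume.real U * q ^ n := by
        rw [setIntegral_const, smul_eq_mul]
        ring
    _ ≤ ∫ s in B, invGammaDensity a b s *
          ∫ β : S → ℝ, modelLikelihood S x y n s β * pmomDensity r τ (A S) s β :=
        setIntegral_mono_on (integrableOn_const hBfin) (hI.mono_set hB0) hB hinner
    _ ≤ _ := by
        refine setIntegral_mono_set hI ?_ (LE.le.eventuallyLE hB0)
        refine (ae_restrict_mem measurableSet_Ioi).mono fun s hs => ?_
        exact mul_nonneg (invGammaDensity_pos ha hb hs).le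
          (integral_modelLikelihood_mul_pmomDensity_nonneg hτ hA hs)

end marginal

/-! ### The mean squared residual as a quadratic function -/

section quadratic

variable {d : ℕ}

/-- The mean squared residual as a function of the empirical second moments `G` of the covariates,
the empirical correlations `h` of covariates and errors, the mean squared error `e`, and the
deviation `u` from the true coefficients. -/
def meanSqResidual (G : Fin d → Fin d → ℝ) (h : Fin d → ℝ) (e : ℝ) (u : Fin d → ℝ) : ℝ :=
  ∑ j, ∑ k, G j k * (u j * u k) + 2 * ∑ j, h j * u j + e

theorem continuous_meanSqResidual :
    Continuous fun p : ((Fin d → Fin d → ℝ) × (Fin d → ℝ) × ℝ) × (Fin d → ℝ) =>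
      meanSqResidual p.1.1 p.1.2.1 p.1.2.2 p.2 := by
  unfold meanSqResidual
  fun_prop

theorem sum_sq_residual_eq (x : ℕ → Fin d → ℝ) (ε : ℕ → ℝ) (u : Fin d → ℝ) (n : ℕ) :
    ∑ i ∈ Finset.range n, (x i ⬝ᵥ u + ε i) ^ 2 = n * meanSqResidual
      (fun j k => (∑ i ∈ Finset.range n, x i j * x i k) / n)
      (fun j => (∑ i ∈ Finset.range n, x i j * ε i) / n)
      ((∑ i ∈ Finset.range n, ε i ^ 2) / n) u := by
  -- At `n = 0` both sides vanish, whatever the quotients by zero are.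
  rcases n.eq_zero_or_pos with rfl | hn
  · simp
  have hn' : (n : ℝ) ≠ 0 := by positivity
  have e1 : ∑ j, ∑ k, (∑ i ∈ Finset.range n, x i j * x i k) / n * (u j * u k) =
      (∑ i ∈ Finset.range n, (x i ⬝ᵥ u) ^ 2) / n := by
    simp only [dotProduct, sq, Finset.sum_mul_sum]
    simp only [Finset.sum_div, Finset.sum_mul]
    rw [Finset.sum_comm]
    refine (Finset.sum_congr rfl fun j _ => ?_).trans Finset.sum_comm
    rw [Finset.sum_comm]
    refine Finset.sum_congr rfl fun i _ => Finset.sum_congr rfl fun k _ => ?_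
    ring
  have e2 : ∑ j, (∑ i ∈ Finset.range n, x i j * ε i) / n * u j =
      (∑ i ∈ Finset.range n, (x i ⬝ᵥ u) * ε i) / n := by
    simp only [dotProduct, Finset.sum_div, Finset.sum_mul]
    rw [Finset.sum_comm]
    refine Finset.sum_congr rfl fun i _ => Finset.sum_congr rfl fun j _ => ?_
    ring
  rw [meanSqResidual, e1, e2]
  field_simp
  rw [Finset.mul_sum, ← Finset.sum_add_distrib, ← Finset.sum_add_distrib]
  refine Finset.sum_congr rfl fun i _ => ?_
  ring

/-- The difference of the true coefficients and those of a submodel. -/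
def coeffDeviation (βt : Fin d → ℝ) (S : Finset (Fin d)) (β : S → ℝ) (j : Fin d) : ℝ :=
  βt j - if h : j ∈ S then β ⟨j, h⟩ else 0

/-- Extending coefficients by zero places all submodels in one space; outside `S` the deviation is
the true coefficient. -/
theorem residual_eq (βt : Fin d → ℝ) (S : Finset (Fin d)) (β : S → ℝ) (z : Fin d → ℝ) (e : ℝ) :
    z ⬝ᵥ βt + e - ∑ j : S, z j * β j = z ⬝ᵥ coeffDeviation βt S β + e := by
  have h : ∑ j : S, z j * β j = ∑ j, z j * (if h : j ∈ S then β ⟨j, h⟩ else 0) := by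
    rw [← Finset.sum_subset (Finset.subset_univ S) (fun j _ hj => by simp [hj]),
      ← Finset.sum_coe_sort S]
    simp
  simp only [h, dotProduct, coeffDeviation, mul_sub, Finset.sum_sub_distrib]
  ring

/-- Deviations with a coordinate bounded away from zero increase the limiting mean squared
residual, uniformly. -/
theorem exists_eventually_lt_meanSqResidual {G : ℕ → Fin d → Fin d → ℝ}
    {G₀ : Fin d → Fin d → ℝ} {h : ℕ → Fin d → ℝ} {e : ℕ → ℝ} {v : ℝ}
    (hG : ∀ j k, Tendsto (fun n => G n j k) atTop (nhds (G₀ j k)))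
    (hh : ∀ j, Tendsto (fun n => h n j) atTop (nhds 0)) (he : Tendsto e atTop (nhds v))
    (hpos : ∀ u : Fin d → ℝ, u ≠ 0 → 0 < ∑ j, ∑ k, G₀ j k * (u j * u k))
    (j₀ : Fin d) {κ : ℝ} (hκ : κ ≠ 0) :
    ∃ w > v, ∀ᶠ n in atTop, ∀ u : Fin d → ℝ, u j₀ = κ →
      w ≤ meanSqResidual (G n) (h n) (e n) u := by
  have hquad : ∀ u : Fin d → ℝ, u ⬝ᵥ (Matrix.of G₀) *ᵥ u = ∑ j, ∑ k, G₀ j k * (u j * u k) := by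
    intro u
    simp only [dotProduct, mulVec, Finset.mul_sum, Matrix.of_apply]
    refine Finset.sum_congr rfl fun i _ => Finset.sum_congr rfl fun j _ => ?_
    ring
  obtain ⟨c, hc, hcoer⟩ := exists_pos_mul_dotProduct_self_le (Matrix.of G₀)
    fun u hu => (hquad u).symm ▸ hpos u hu
  have hκ2 : 0 < κ ^ 2 := by positivity
  -- Since `u` is unbounded, errors in the moments must be absorbed by coercivity. Errors up to `η`
  -- cost at most `(d + 1) * η * (u ⬝ᵥ u) + (d + 1) * η`: the first bound on `η` preserves half of
  -- `c`, the second spends half of the remaining gain `c * κ ^ 2 / 2`.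
  obtain ⟨η, hη, hη1, hη2⟩ : ∃ η > 0, (d + 1) * η ≤ c / 2 ∧ (d + 1) * η ≤ c * κ ^ 2 / 4 := by
    refine ⟨min (c / 2) (c * κ ^ 2 / 4) / (d + 1), by positivity, ?_, ?_⟩
    · rw [mul_div_cancel₀ _ (by positivity)]
      exact min_le_left _ _
    · rw [mul_div_cancel₀ _ (by positivity)]
      exact min_le_right _ _
  refine ⟨v + c * κ ^ 2 / 4, by linarith [mul_pos hc hκ2], ?_⟩
  have near : ∀ {f : ℕ → ℝ} {l : ℝ}, Tendsto f atTop (nhds l) → ∀ᶠ n in atTop, |f n - l| ≤ η := by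
    intro f l hf
    filter_upwards [hf (Metric.ball_mem_nhds l hη)] with n hn
    exact (Real.dist_eq _ _ ▸ Metric.mem_ball.1 hn).le
  filter_upwards [eventually_all.2 fun j => eventually_all.2 fun k => near (hG j k),
    eventually_all.2 fun j => near (hh j), near he] with n hGn hhn hen u hu
  have hsq : κ ^ 2 ≤ u ⬝ᵥ u := by
    rw [← hu, sq]
    exact Finset.single_le_sum (f := fun j => u j * u j) (fun j _ => mul_self_nonneg _)
      (Finset.mem_univ j₀)
  have hT : (∑ j, |u j|) ^ 2 ≤ d * (u ⬝ᵥ u) := by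
    have := sq_sum_le_card_mul_sum_sq (s := Finset.univ) (f := fun j => |u j|)
    simpa [dotProduct, sq] using this
  have h1 : ∑ j, ∑ k, G₀ j k * (u j * u k) - ∑ j, ∑ k, G n j k * (u j * u k) ≤
      η * (∑ j, |u j|) ^ 2 := by
    rw [sq, Finset.sum_mul_sum]
    simp only [Finset.mul_sum, ← Finset.sum_sub_distrib]
    refine Finset.sum_le_sum fun j _ => Finset.sum_le_sum fun k _ => ?_
    rw [← sub_mul, ← abs_mul]
    refine (le_abs_self _).trans ?_
    rw [abs_mul, abs_sub_comm]
    exact mul_le_mul_of_nonneg_right (hGn j k) (abs_nonneg _)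
  have h2 : -(2 * ∑ j, h n j * u j) ≤ η * (u ⬝ᵥ u + d) := by
    have : ∑ j, -(2 * (h n j * u j)) ≤ ∑ j, η * (u j * u j + 1) := by
      refine Finset.sum_le_sum fun j _ => ?_
      have hj := hhn j
      rw [sub_zero] at hj
      have h3 : -(h n j * u j) ≤ η * |u j| := by
        refine (neg_le_abs _).trans ?_
        rw [abs_mul]
        exact mul_le_mul_of_nonneg_right hj (abs_nonneg _)
      -- This is `2 * |u j| ≤ u j ^ 2 + 1`.
      nlinarith [sq_nonneg (|u j| - 1), abs_mul_abs_self (u j)]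
    simpa [Finset.sum_neg_distrib, ← Finset.mul_sum, dotProduct, Finset.sum_add_distrib] using this
  have h4 := hcoer u
  rw [hquad u] at h4
  have h5 := (abs_le.1 hen).1
  have h6 := mul_le_mul_of_nonneg_left hT hη.le
  have h7 : (c - (d + 1) * η) * κ ^ 2 ≤ (c - (d + 1) * η) * (u ⬝ᵥ u) :=
    mul_le_mul_of_nonneg_left hsq (by linarith)
  have h8 : c / 2 * κ ^ 2 ≤ (c - (d + 1) * η) * κ ^ 2 :=
    mul_le_mul_of_nonneg_right (by linarith) hκ2.le
  unfold meanSqResidual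
  nlinarith

/-- Small deviations hardly increase the limiting mean squared residual. -/
theorem exists_eventually_meanSqResidual_le {G : ℕ → Fin d → Fin d → ℝ}
    {G₀ : Fin d → Fin d → ℝ} {h : ℕ → Fin d → ℝ} {e : ℕ → ℝ} {v w : ℝ}
    (hG : ∀ j k, Tendsto (fun n => G n j k) atTop (nhds (G₀ j k)))
    (hh : ∀ j, Tendsto (fun n => h n j) atTop (nhds 0)) (he : Tendsto e atTop (nhds v))
    (hw : v < w) :
    ∃ ρ > 0, ∀ᶠ n in atTop, ∀ u : Fin d → ℝ, ‖u‖ < ρ →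
      meanSqResidual (G n) (h n) (e n) u ≤ w := by
  have h0 : meanSqResidual G₀ (0 : Fin d → ℝ) v 0 < w := by simpa [meanSqResidual] using hw
  have hev := continuous_meanSqResidual.continuousAt.eventually_lt
    (x₀ := ((G₀, (0 : Fin d → ℝ), v), (0 : Fin d → ℝ))) continuousAt_const h0
  -- A product neighbourhood separates the moments from the deviation, so `ρ` does not depend on
  -- `n`.
  rw [nhds_prod_eq, Filter.eventually_prod_iff] at hev
  obtain ⟨pa, hpa, pb, hpb, hab⟩ := hev
  obtain ⟨ρ, hρ, hball⟩ := Metric.eventually_nhds_iff.1 hpb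
  have hlim : Tendsto (fun n => (G n, h n, e n)) atTop (nhds (G₀, (0 : Fin d → ℝ), v)) :=
    (tendsto_pi_nhds.2 fun j => tendsto_pi_nhds.2 fun k => hG j k).prodMk_nhds
      ((tendsto_pi_nhds.2 fun j => hh j).prodMk_nhds he)
  refine ⟨ρ, hρ, (hlim.eventually hpa).mono fun n hn u hu => ?_⟩
  exact (hab hn (hball (by simpa using hu))).le

end quadratic

/-! ### Exponential decay of the Bayes factor along one sample path -/

/-- A model that misses a nonzero coefficient is dominated by the full model as soon as the
empirical second moments converge to those of a nondegenerate linear model. -/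
theorem tendsto_pmomBayesFactor_zero {d : ℕ} {x : ℕ → Fin d → ℝ} {ε y : ℕ → ℝ}
    {βt : Fin d → ℝ} (hβ : ∀ j, βt j ≠ 0) (hy : ∀ i, y i = x i ⬝ᵥ βt + ε i)
    {G₀ : Fin d → Fin d → ℝ} {v : ℝ} (hv : 0 < v)
    (hG : ∀ j k, Tendsto (fun n : ℕ => (∑ i ∈ Finset.range n, x i j * x i k) / n) atTop
      (nhds (G₀ j k)))
    (hh : ∀ j, Tendsto (fun n : ℕ => (∑ i ∈ Finset.range n, x i j * ε i) / n) atTop (nhds 0))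
    (he : Tendsto (fun n : ℕ => (∑ i ∈ Finset.range n, ε i ^ 2) / n) atTop (nhds v))
    (hpos : ∀ u : Fin d → ℝ, u ≠ 0 → 0 < ∑ j, ∑ k, G₀ j k * (u j * u k))
    {S : Finset (Fin d)} {j₀ : Fin d} (hj₀ : j₀ ∉ S) (r : ℕ) {τ : ℝ} (hτ : 0 < τ)
    {A : ∀ S : Finset (Fin d), Matrix S S ℝ} (hA : ∀ S, (A S).PosDef)
    {a b : ℝ} (ha : 0 < a) (hb : 0 < b) :
    Tendsto (fun n => pmomBayesFactor r τ A a b S Finset.univ x y n) atTop (nhds 0) := by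
  have hres : ∀ (M : Finset (Fin d)) (β : M → ℝ) (n : ℕ),
      ∑ i ∈ Finset.range n, (y i - ∑ j : M, x i j * β j) ^ 2 = n * meanSqResidual
        (fun j k => (∑ i ∈ Finset.range n, x i j * x i k) / n)
        (fun j => (∑ i ∈ Finset.range n, x i j * ε i) / n)
        ((∑ i ∈ Finset.range n, ε i ^ 2) / n) (coeffDeviation βt M β) := by
    intro M β n
    simp only [hy, residual_eq, sum_sq_residual_eq]
  obtain ⟨w, hvw, hlow⟩ := exists_eventually_lt_meanSqResidual hG hh he hpos j₀ (hβ j₀)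
  -- In the full model `s₀` serves both as noise variance and as bound of the mean squared residual;
  -- `s₀ < w` gives the better rate.
  obtain ⟨s₀, hvs, hsw⟩ := exists_between hvw
  have hw : 0 < w := hv.trans hvw
  have hs₀ : 0 < s₀ := hv.trans hvs
  obtain ⟨ρ, hρ, hupp⟩ := exists_eventually_meanSqResidual_le hG hh he hvs
  set q := (√(2 * Real.pi * w))⁻¹ * Real.exp (-(1 / 2)) with hq
  have hq0 : 0 < q := by positivity
  have hqs : q < (√(2 * Real.pi * s₀))⁻¹ * Real.exp (-(s₀ / (2 * s₀))) := by
    have e : s₀ / (2 * s₀) = 1 / 2 := by field_simp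
    rw [hq, e]
    gcongr
  -- The slack below the rate at `s₀` lets the variance range over a ball of positive measure.
  obtain ⟨q', hqq', hq's⟩ := exists_between hqs
  have hq'0 : 0 < q' := hq0.trans hqq'
  let β₀ : ↥(Finset.univ : Finset (Fin d)) → ℝ := fun j => βt j
  obtain ⟨c, hc0, hc⟩ : ∃ c > 0, c < invGammaDensity a b s₀ *
      pmomDensity r τ (A Finset.univ) s₀ β₀ :=
    exists_between (mul_pos (invGammaDensity_pos ha hb hs₀)
      (pmomDensity_pos r hτ (hA _) hs₀ fun j => hβ j))
  have hcont1 : ContinuousAt (fun p : ℝ × (↥(Finset.univ : Finset (Fin d)) → ℝ) =>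
      invGammaDensity a b p.1 * pmomDensity r τ (A Finset.univ) p.1 p.2) (s₀, β₀) :=
    ContinuousAt.mul (ContinuousAt.comp (g := invGammaDensity a b) (x := (s₀, β₀))
      (continuousAt_invGammaDensity a b hs₀) continuousAt_fst)
      (continuousAt_pmomDensity r hτ _ hs₀ _)
  have hcont2 : ContinuousAt (fun s : ℝ =>
      (√(2 * Real.pi * s))⁻¹ * Real.exp (-(s₀ / (2 * s)))) s₀ := by
    refine ContinuousAt.mul (ContinuousAt.inv₀ (by fun_prop) (by positivity)) ?_
    exact (ContinuousAt.div (by fun_prop) (by fun_prop) (by positivity)).neg.rexp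
  have hev1 := continuousAt_const.eventually_lt hcont1 hc
  rw [nhds_prod_eq, Filter.eventually_prod_iff] at hev1
  obtain ⟨pa, hpa, pb, hpb, hab⟩ := hev1
  obtain ⟨η, hη, hBall⟩ := Metric.eventually_nhds_iff.1
    ((hpa.and (continuousAt_const.eventually_lt hcont2 hq's)).and (eventually_gt_nhds hs₀))
  obtain ⟨ρ', hρ', hUall⟩ := Metric.eventually_nhds_iff.1 hpb
  set B := Metric.ball s₀ η
  set U := Metric.ball β₀ (min ρ ρ')
  have hUpos : 0 < volume.real U :=
    ENNReal.toReal_pos (Metric.measure_ball_pos _ _ (lt_min hρ hρ')).ne' measure_ball_lt_top.ne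
  have hBpos : 0 < volume.real B :=
    ENNReal.toReal_pos (Metric.measure_ball_pos _ _ hη).ne' measure_ball_lt_top.ne
  set K := c * volume.real U * volume.real B
  have hK : 0 < K := by positivity
  set C := ∫ s in Set.Ioi 0, invGammaDensity a b s
  have hbound : ∀ᶠ n in atTop, pmomBayesFactor r τ A a b S Finset.univ x y n ≤
      C / K * (q / q') ^ n := by
    filter_upwards [hlow, hupp] with n hln hun
    have hnum : pmomMarginal r τ A a b S x y n ≤ C * q ^ n := by
      refine pmomMarginal_le hτ (hA S) ha hb hw fun β => ?_
      rw [hres]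
      -- As `j₀ ∉ S`, the deviation at `j₀` equals `βt j₀` for every choice of coefficients.
      exact mul_le_mul_of_nonneg_left (hln _ (by simp [coeffDeviation, hj₀])) n.cast_nonneg
    have hden : K * q' ^ n ≤ pmomMarginal r τ A a b Finset.univ x y n := by
      refine le_pmomMarginal (w := s₀) hτ (hA _) ha hb measurableSet_ball
        (fun s hs => (hBall hs).2)
        measure_ball_lt_top.ne measurableSet_ball measure_ball_lt_top.ne hc0.le hq'0.le
        (fun s hs β hβU => (hab (hBall hs).1.1
          (hUall ((Metric.mem_ball.1 hβU).trans_le (min_le_right _ _)))).le)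
        (fun s hs => (hBall hs).1.2.le) fun β hβU => ?_
      rw [hres]
      refine mul_le_mul_of_nonneg_left (hun _ ?_) n.cast_nonneg
      have hβρ := (Metric.mem_ball.1 hβU).trans_le (min_le_left _ _)
      rw [dist_pi_lt_iff hρ] at hβρ
      rw [pi_norm_lt_iff hρ]
      intro j
      have := hβρ ⟨j, Finset.mem_univ j⟩
      rw [dist_comm, dist_eq_norm] at this
      simpa [coeffDeviation] using this
    have hC : 0 ≤ C := setIntegral_nonneg measurableSet_Ioi fun s hs =>
      (invGammaDensity_pos ha hb hs).le
    calc pmomBayesFactor r τ A a b S Finset.univ x y n ≤ C * q ^ n / (K * q' ^ n) :=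
          div_le_div₀ (by positivity) hnum (by positivity) hden
      _ = C / K * (q / q') ^ n := by
          rw [div_pow, div_mul_div_comm]
  have hgeom : Tendsto (fun n : ℕ => C / K * (q / q') ^ n) atTop (nhds 0) := by
    have := (tendsto_pow_atTop_nhds_zero_of_lt_one (div_pos hq0 hq'0).le
      ((div_lt_one hq'0).2 hqq')).const_mul (C / K)
    simpa using this
  refine tendsto_of_tendsto_of_tendsto_of_le_of_le' tendsto_const_nhds hgeom
    (Eventually.of_forall fun n => ?_) hbound
  exact div_nonneg (pmomMarginal_nonneg hτ (hA _) ha hb) (pmomMarginal_nonneg hτ (hA _) ha hb)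

/-! ### Laws of large numbers and conclusion -/

/-- The strong law of large numbers for a real function of i.i.d. samples. -/
theorem strong_law_ae_comp {Ω E : Type*} [MeasurableSpace Ω] [MeasurableSpace E] {μ : Measure Ω}
    {Z : ℕ → Ω → E} (hZ : ∀ i, Measurable (Z i)) (hind : iIndepFun Z μ)
    {ν : Measure E} (hlaw : ∀ i, μ.map (Z i) = ν) {f : E → ℝ} (hf : Measurable f)
    (hint : Integrable f ν) :
    ∀ᵐ ω ∂μ, Tendsto (fun n : ℕ => (∑ i ∈ Finset.range n, f (Z i ω)) / n) atTop
      (nhds (∫ z, f z ∂ν)) := by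
  have h := strong_law_ae_real (μ := μ) (fun i ω => f (Z i ω))
    (Integrable.comp_measurable (f := Z 0) (by rwa [hlaw]) (hZ 0))
    (fun i j hij => (hind.indepFun hij).comp hf hf)
    (fun i => IdentDistrib.comp ⟨(hZ i).aemeasurable, (hZ 0).aemeasurable, by simp [hlaw]⟩ hf)
  have e : ∫ ω, f (Z 0 ω) ∂μ = ∫ z, f z ∂ν := by
    rw [← hlaw 0, integral_map (hZ 0).aemeasurable hf.aestronglyMeasurable]
  rwa [← e]

/-- The second moments of a nondegenerate distribution form a positive definite matrix. -/
theorem sum_secondMoment_pos {d : ℕ} {P : Measure (Fin d → ℝ)}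
    (hint : ∀ j k, Integrable (fun z : Fin d → ℝ => z j * z k) P)
    (hPnd : ∀ u : Fin d → ℝ, u ≠ 0 → ¬ ∀ᵐ z ∂P, u ⬝ᵥ z = 0) {u : Fin d → ℝ} (hu : u ≠ 0) :
    0 < ∑ j, ∑ k, (∫ z, z j * z k ∂P) * (u j * u k) := by
  have hsq : ∀ z : Fin d → ℝ, (u ⬝ᵥ z) ^ 2 = ∑ j, ∑ k, z j * z k * (u j * u k) := by
    intro z
    rw [sq, dotProduct, Finset.sum_mul_sum]
    refine Finset.sum_congr rfl fun i _ => Finset.sum_congr rfl fun k _ => ?_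
    ring
  have hi : ∀ j, Integrable (fun z : Fin d → ℝ => ∑ k, z j * z k * (u j * u k)) P :=
    fun j => integrable_finsetSum _ fun k _ => (hint j k).mul_const _
  have hint2 : Integrable (fun z : Fin d → ℝ => (u ⬝ᵥ z) ^ 2) P := by
    simp only [hsq]
    exact integrable_finsetSum _ fun j _ => hi j
  have e : ∑ j, ∑ k, (∫ z, z j * z k ∂P) * (u j * u k) = ∫ z, (u ⬝ᵥ z) ^ 2 ∂P := by
    simp only [hsq]
    rw [integral_finsetSum _ fun j _ => hi j]
    refine Finset.sum_congr rfl fun j _ => ?_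
    rw [integral_finsetSum _ fun k _ => (hint j k).mul_const _]
    simp only [integral_mul_const]
  rw [e]
  -- A vanishing second moment of `u ⬝ᵥ z` would put the distribution on a hyperplane.
  refine lt_of_le_of_ne (integral_nonneg fun z => sq_nonneg _) fun h0 => hPnd u hu ?_
  have := (integral_eq_zero_iff_of_nonneg (fun z => sq_nonneg (u ⬝ᵥ z)) hint2).1 h0.symm
  exact this.mono fun z hz => by simpa using hz

theorem theorem3 {d : ℕ} {Ω : Type*} [MeasurableSpace Ω] (μ : Measure Ω) [IsProbabilityMeasure μ]
    -- covariate distribution: finite second moments, not carried by a hyperplane through 0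
    (P : Measure (Fin d → ℝ)) (hP : MemLp id 2 P)
    (hPnd : ∀ u : Fin d → ℝ, u ≠ 0 → ¬ ∀ᵐ z ∂P, u ⬝ᵥ z = 0)
    -- true parameters; the coefficient vector is quasi-sparse
    (βt : Fin d → ℝ) (vt : ℝ≥0) (hvt : 0 < vt) (δ : ℝ) (hδ : 0 < δ)
    (hβ : ∀ j, βt j ≠ 0) (hS : (relevantSet δ βt).card < d)
    -- i.i.d. samples from the true normal linear model
    (x : ℕ → Ω → Fin d → ℝ) (ε y : ℕ → Ω → ℝ)
    (hxm : ∀ i, Measurable (x i)) (hεm : ∀ i, Measurable (ε i))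
    (hx : ∀ i, μ.map (x i) = P) (hε : ∀ i, μ.map (ε i) = gaussianReal 0 vt)
    (hxε : ∀ i, IndepFun (x i) (ε i) μ)
    (hind : iIndepFun (fun i ω => (x i ω, ε i ω)) μ)
    (hy : ∀ i ω, y i ω = x i ω ⬝ᵥ βt + ε i ω)
    -- hyperparameters of the product moment prior and of the prior on the noise variance
    (r : ℕ) (hr : 1 ≤ r) (τ : ℝ) (hτ : 0 < τ)
    (A : ∀ S : Finset (Fin d), Matrix S S ℝ) (hA : ∀ S, (A S).PosDef)
    (a b : ℝ) (ha : 0 < a) (hb : 0 < b) :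
    TendstoInMeasure μ
      (fun n ω => pmomBayesFactor r τ A a b (relevantSet δ βt) Finset.univ
        (fun i => x i ω) (fun i => y i ω) n)
      atTop (fun _ => (0 : ℝ)) := by
  have hPp : IsProbabilityMeasure P :=
    hx 0 ▸ Measure.isProbabilityMeasure_map (hxm 0).aemeasurable
  have hcoord : ∀ j, MemLp (fun z : Fin d → ℝ => z j) 2 P := fun j =>
    hP.mono (measurable_pi_apply j).aestronglyMeasurable
      (ae_of_all _ fun z => norm_le_pi_norm z j)
  have hGint : ∀ j k, Integrable (fun z : Fin d → ℝ => z j * z k) P := fun j k =>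
    (hcoord j).integrable_mul (hcoord k)
  have hgauss : MemLp (fun t : ℝ => t) 2 (gaussianReal 0 vt) := memLp_id_gaussianReal 2
  have hZm : ∀ i, Measurable fun ω => (x i ω, ε i ω) := fun i => (hxm i).prodMk (hεm i)
  have hlaw : ∀ i, μ.map (fun ω => (x i ω, ε i ω)) = P.prod (gaussianReal 0 vt) := fun i => by
    rw [(indepFun_iff_map_prod_eq_prod_map_map (hxm i).aemeasurable (hεm i).aemeasurable).1
      (hxε i), hx, hε]
  have hG := ae_all_iff.2 fun j => ae_all_iff.2 fun k => strong_law_ae_comp hZm hind hlaw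
    (f := fun p => p.1 j * p.1 k) (by fun_prop) ((hGint j k).comp_fst _)
  have hh := ae_all_iff.2 fun j => strong_law_ae_comp hZm hind hlaw
    (f := fun p => p.1 j * p.2) (by fun_prop)
    (((hcoord j).integrable one_le_two).mul_prod (hgauss.integrable one_le_two))
  have he := strong_law_ae_comp hZm hind hlaw
    (f := fun p => p.2 ^ 2) (by fun_prop) (hgauss.integrable_sq.comp_snd _)
  have eG : ∀ j k, ∫ p, p.1 j * p.1 k ∂(P.prod (gaussianReal 0 vt)) = ∫ z, z j * z k ∂P := by
    intro j k
    rw [integral_fun_fst (fun z : Fin d → ℝ => z j * z k)]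
    simp
  -- The noise is centered and independent of the covariates, so the cross moments factor and
  -- vanish.
  have eh : ∀ j, ∫ p, p.1 j * p.2 ∂(P.prod (gaussianReal 0 vt)) = 0 := by
    intro j
    rw [integral_prod_mul (fun z : Fin d → ℝ => z j) (fun t : ℝ => t)]
    simp
  have ee : ∫ p, p.2 ^ 2 ∂(P.prod (gaussianReal 0 vt)) = vt := by
    rw [integral_fun_snd (fun t : ℝ => t ^ 2)]
    have := variance_of_integral_eq_zero (μ := gaussianReal 0 vt) (X := fun t => t)
      measurable_id.aemeasurable (by simp)
    simp only [variance_fun_id_gaussianReal] at this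
    simp [this]
  simp only [eG, eh, ee] at hG hh he
  -- Quasi-sparsity provides a covariate that is omitted although its coefficient is nonzero.
  obtain ⟨j₀, hj₀⟩ : ∃ j₀, j₀ ∉ relevantSet δ βt := by
    by_contra! hall
    rw [Finset.eq_univ_iff_forall.2 hall] at hS
    simp at hS
  have hym : ∀ i, Measurable (y i) := fun i => by
    have : y i = fun ω => x i ω ⬝ᵥ βt + ε i ω := funext (hy i)
    rw [this]
    have hd : Measurable fun z : Fin d → ℝ => z ⬝ᵥ βt := Continuous.measurable (by fun_prop)
    exact (hd.comp (hxm i)).add (hεm i)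
  refine tendstoInMeasure_of_tendsto_ae (fun n => ?_) ?_
  · exact ((measurable_pmomMarginal _ hxm hym n r τ A a b).div
      (measurable_pmomMarginal _ hxm hym n r τ A a b)).aestronglyMeasurable
  · filter_upwards [hG, hh, he] with ω hGω hhω heω
    exact tendsto_pmomBayesFactor_zero hβ (fun i => hy i ω) (NNReal.coe_pos.2 hvt) hGω hhω heω
      (fun u hu => sum_secondMoment_pos hGint hPnd hu) hj₀ r hτ hA ha hb
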